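/- Let $\mathcal X$ be a finite set (with its discrete $\sigma$-algebra) and let $\mathbf P$ be a random field on $\mathbb Z^\nu$, i.e. a probability measure on $\mathcal X^{\mathbb Z^\nu}$ with finite-dimensional distributions $\mathbf P_\Lambda$, $\Lambda\subset\mathbb Z^\nu$ finite. **Definitions.** $\mathbf P$ is *strictly positive* if $\mathbf P_\Lambda(x)>0$ for all finite $\Lambda$ and all $x\in\mathcal X^\Lambda$. For disjoint finite $\Lambda, M$, and $x\in\mathcal X^\Lambda$, $z\in\mathcal X^M$, put $q_\Lambda^{z}(x)=\mathbf P_{\Lambda\cup M}(xz)/\mathbf P_M(z)$ (defined when $\mathbf P_M(z)>0$); the one-point finite-conditional distribution is the system of all $q_t^{z}=q_{\{t\}}^{z}$ with $t\in\mathbb Z^\nu$ and $z\in\widetilde{\mathcal X^t}$, the set of configurations with non-empty finite support contained in $\{t\}^c$. For strictly positive $\mathbf P$ it is *uniformly nonnull* if $\inf_{z\in\widetilde{\mathcal X^t}}q_t^z(x)>0$ for every $t\in\mathbb Z^\nu$ and $x\in\mathcal X$. A (real-valued) potential $\Phi$, i.e. a real function of the configurations with non-empty finite support, is *uniformly convergent*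 if for all $t\in\mathbb Z^\nu$ and $x\in\mathcal X^{t}$ the (unordered) series $\sum_{J}\Phi(x\bar x_J)$ over all finite $J\subset\{t\}^c$ converges for every $\bar x\in\mathcal X^{\{t\}^c}$, uniformly in $\bar x$. Its Gibbsian specification is $$Q_\Lambda^{\bar x}(x)=\frac{e^{-U_\Lambda^{\bar x}(x)}}{\sum_{y\in\mathcal X^\Lambda}e^{-U_\Lambda^{\bar x}(y)}},\qquad U_\Lambda^{\bar x}(x)=\sum_{\emptyset\ne J\subset\Lambda}\ \sum_{\tilde J\subset\Lambda^c\text{ finite}}\Phi(x_J\bar x_{\tilde J}),$$ for finite $\Lambda$, $x\in\mathcal X^\Lambda$, $\bar x\in\mathcal X^{\Lambda^c}$. $\mathbf P$ is a *Gibbs random field* if for some uniformly convergent $\Phi$ the system $Q$ is a version of the conditional distribution of $\mathbf P$, that is, for every finite $\Lambda$ and every increasing sequence of finite sets $M_n\uparrow\Lambda^c$, for almost every $\bar x$ with respect to the marginal $\mathbf P_{\Lambda^c}$, $q_\Lambda^{\bar x_{M_n}}(x)\to Q_\Lambda^{\bar x}(x)$ for all $x\in\mathcal X^\Lambda$. Consider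 the following conditions, where $\Lambda$ runs over the finite subsets of $\{t\}^c$, and where writing $z_\Lambda$ presumes that the support of $z$ contains $\Lambda$. * **(C)** for any $t\in\mathbb Z^\nu$ and $x\in\mathcal X^t$: $\displaystyle\lim_{\Lambda\uparrow\mathbb Z^\nu\setminus t}\ \sup_{z,w\in\widetilde{\mathcal X^t}:\ z_\Lambda=w_\Lambda}\bigl|q_t^{z}(x)-q_t^{w}(x)\bigr|=0$; * **(D)** for any $t\in\mathbb Z^\nu$ and $x\in\mathcal X^t$: $\displaystyle\lim_{\Lambda\uparrow\mathbb Z^\nu\setminus t}\ \sup_{\emptyset\ne J\subset\{t\}^c\text{ finite}}\ \sup_{z,w\in\mathcal X^J:\ z_\Lambda=w_\Lambda}\bigl|q_t^{z}(x)-q_t^{w}(x)\bigr|=0$; * **(E)** for any $t\in\mathbb Z^\nu$ and $x\in\mathcal X^t$: $\displaystyle\lim_{\Lambda\uparrow\mathbb Z^\nu\setminus t}\ \sup_{z\in\widetilde{\mathcal X^t}}\bigl|q_t^{z}(x)-q_t^{z_\Lambda}(x)\bigr|=0$. **Theorem.** If $\mathbf P$ is strictly positive, then (C), (D) and (E) are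 equivalent. Moreover, $\mathbf P$ is a Gibbs random field if and only if it is strictly positive, its one-point finite-conditional distribution is uniformly nonnull, and one (equivalently, each) of the conditions (C), (D), (E) holds. -/

import Mathlib

open MeasureTheory Filter Topology

namespace GibbsField

/-- The integer lattice `ℤ^ν`. -/
abbrev Site (ν : ℕ) : Type := Fin ν → ℤ

/-- The space `X^Λ` of configurations on a finite set `Λ` of sites. -/
abbrev Config {ν : ℕ} (X : Type*) (Λ : Finset (Site ν)) : Type _ := Λ → X

/-- The space `X^{Λᶜ}` of configurations on the whole exterior of `Λ`. -/
abbrev OuterConfig {ν : ℕ} (X : Type*) (Λ : Finset (Site ν)) : Type _ := {s : Site ν // s ∉ Λ} → X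

/-- The finite (possibly empty) subsets of `Λᶜ`, ordered by inclusion. The filter `atTop` on this
type expresses the limit `M ↑ ℤ^ν \ Λ`. -/
abbrev OuterVol {ν : ℕ} (Λ : Finset (Site ν)) : Type := {M : Finset (Site ν) // Disjoint Λ M}

/-- Configurations with non-empty finite support contained in the exterior of `Λ`. -/
structure FinOuterConfig {ν : ℕ} (X : Type*) (Λ : Finset (Site ν)) where
  support : Finset (Site ν)
  nonempty : support.Nonempty
  disjoint : Disjoint Λ support
  val : Config X support

/-- The concatenation `x y` of configurations `x` on `Λ` and `y` on `M` (`Λ`, `M` disjoint). -/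
def concat {ν : ℕ} {X : Type*} {Λ M : Finset (Site ν)} (x : Config X Λ) (y : Config X M) :
    Config X (Λ ∪ M) :=
  fun s => if h : s.1 ∈ Λ then x ⟨s.1, h⟩
    else y ⟨s.1, (Finset.mem_union.mp s.2).resolve_left h⟩

/-- The concatenation of `x` on `Λ` and `xbar` on `Λᶜ`, a configuration on all of `ℤ^ν`. -/
def glue {ν : ℕ} {X : Type*} {Λ : Finset (Site ν)} (x : Config X Λ) (xbar : OuterConfig X Λ) :
    Site ν → X :=
  fun s => if h : s ∈ Λ then x ⟨s, h⟩ else xbar ⟨s, h⟩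

/-- Restriction of a configuration on `Λᶜ` to a finite subset `M` of `Λᶜ`. -/
def OuterConfig.onVol {ν : ℕ} {X : Type*} {Λ : Finset (Site ν)} (xbar : OuterConfig X Λ)
    (M : OuterVol Λ) : Config X M.1 :=
  fun s => xbar ⟨s.1, Finset.disjoint_right.mp M.2 s.2⟩

/-- The configuration on the single site `t` with value `a`. -/
def single {ν : ℕ} {X : Type*} (t : Site ν) (a : X) : Config X {t} := fun _ => a

/-- The finite-dimensional distribution `P_Λ(x)`. -/
noncomputable def fdd {ν : ℕ} {X : Type*} [MeasurableSpace X] (P : Measure (Site ν → X))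
    (Λ : Finset (Site ν)) (x : Config X Λ) : ℝ :=
  (P.map Λ.restrict).real {x}

/-- The marginal `P_{Λᶜ}` of `P` on the exterior of `Λ`. -/
noncomputable def outerMarginal {ν : ℕ} {X : Type*} [MeasurableSpace X] (P : Measure (Site ν → X))
    (Λ : Finset (Site ν)) : Measure (OuterConfig X Λ) :=
  P.map (fun ω s => ω s.1)

/-- Strict positivity of all finite-dimensional distributions. -/
def StrictlyPositive {ν : ℕ} {X : Type*} [MeasurableSpace X] (P : Measure (Site ν → X)) : Prop :=
  ∀ (Λ : Finset (Site ν)) (x : Config X Λ), 0 < fdd P Λ x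

/-- The finite-conditional probability `q_Λ^z(x) = P_{Λ ∪ M}(x z) / P_M(z)`, where `z` is a
configuration on a finite set `M` disjoint from `Λ`. -/
noncomputable def finCond {ν : ℕ} {X : Type*} [MeasurableSpace X] (P : Measure (Site ν → X))
    (Λ : Finset (Site ν)) {M : Finset (Site ν)} (z : Config X M) (x : Config X Λ) : ℝ :=
  fdd P (Λ ∪ M) (concat x z) / fdd P M z

/-- The one-point finite-conditional probability `q_t^z(a)`. -/
noncomputable def onePoint {ν : ℕ} {X : Type*} [MeasurableSpace X] (P : Measure (Site ν → X))
    (t : Site ν) {M : Finset (Site ν)} (z : Config X M) (a : X) : ℝ :=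
  finCond P {t} z (single t a)

/-- A system of real-valued functions `Q Λ xbar` on `X^Λ`, `Λ` finite, `xbar ∈ X^{Λᶜ}`. -/
abbrev CondSystem (ν : ℕ) (X : Type*) : Type _ :=
  (Λ : Finset (Site ν)) → OuterConfig X Λ → Config X Λ → ℝ

/-- `Q` is a version of the conditional distribution of `P`: a system of probability distributions
such that, for every finite `Λ`, `Q Λ xbar x` is for `P_{Λᶜ}`-almost every `xbar` the limit of
the finite-conditional probabilities of `x` given the restriction of `xbar` to `M`, as `M`
increases to `Λᶜ`. The almost sure limit is taken along increasing sequences of finite sets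
exhausting `Λᶜ` (the exceptional null set may depend on the sequence). -/
def IsConditionalDistribution {ν : ℕ} {X : Type*} [Fintype X] [MeasurableSpace X]
    (P : Measure (Site ν → X)) (Q : CondSystem ν X) : Prop :=
  (∀ (Λ : Finset (Site ν)) (xbar : OuterConfig X Λ),
    (∀ x, 0 ≤ Q Λ xbar x) ∧ ∑ x, Q Λ xbar x = 1) ∧
  ∀ (Λ : Finset (Site ν)) (M : ℕ → OuterVol Λ), Monotone M → (∀ s ∉ Λ, ∃ n, s ∈ (M n).1) →
    ∀ᵐ xbar ∂(outerMarginal P Λ), ∀ x : Config X Λ,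
      Tendsto (fun n => finCond P Λ (xbar.onVol (M n)) x) atTop (𝓝 (Q Λ xbar x))

/-- A real-valued interaction potential: a function of configurations with non-empty finite
support. (The value on the empty configuration is never used.) -/
abbrev Potential (ν : ℕ) (X : Type*) : Type _ := (A : Finset (Site ν)) → Config X A → ℝ

/-- The term `Φ(x_J xbar_K)` for `J ⊆ Λ` and a finite `K ⊆ Λᶜ`. -/
def Potential.term {ν : ℕ} {X : Type*} (Φ : Potential ν X) {Λ : Finset (Site ν)} (x : Config X Λ)
    (xbar : OuterConfig X Λ) (J : Finset (Site ν)) (K : OuterVol Λ) : ℝ :=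
  Φ (J ∪ K.1) ((J ∪ K.1).restrict (glue x xbar))

/-- `Φ` is uniformly convergent: for every site `t` and value `a`, the series
`∑_K Φ(a xbar_K)` over all finite `K ⊆ {t}ᶜ` converges for every `xbar`, uniformly in `xbar`.
The index set carries no order: convergence is that of the net of finite partial sums. -/
def Potential.UniformlyConvergent {ν : ℕ} {X : Type*} (Φ : Potential ν X) : Prop :=
  ∀ (t : Site ν) (a : X),
    (∀ xbar : OuterConfig X {t},
      Summable (fun K : OuterVol {t} => Φ.term (single t a) xbar {t} K)) ∧
    TendstoUniformly
      (fun (F : Finset (OuterVol {t})) (xbar : OuterConfig X {t}) =>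
        ∑ K ∈ F, Φ.term (single t a) xbar {t} K)
      (fun xbar => ∑' K : OuterVol {t}, Φ.term (single t a) xbar {t} K) atTop

/-- The energy `U_Λ^{xbar}(x) = ∑_{∅ ≠ J ⊆ Λ} ∑_K Φ(x_J xbar_K)`, `K` ranging over the finite
subsets of `Λᶜ`. -/
noncomputable def Potential.energy {ν : ℕ} {X : Type*} (Φ : Potential ν X) (Λ : Finset (Site ν))
    (xbar : OuterConfig X Λ) (x : Config X Λ) : ℝ :=
  ∑ J ∈ Λ.powerset with J.Nonempty, ∑' K : OuterVol Λ, Φ.term x xbar J K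

/-- The Gibbsian specification with potential `Φ`. -/
noncomputable def Potential.gibbsSpec {ν : ℕ} {X : Type*} [Fintype X] (Φ : Potential ν X) :
    CondSystem ν X :=
  fun Λ xbar x => Real.exp (-Φ.energy Λ xbar x) / ∑ y : Config X Λ, Real.exp (-Φ.energy Λ xbar y)

/-- `P` is a Gibbs random field: it is compatible with the Gibbsian specification of some uniformly
convergent potential. -/
def IsGibbs {ν : ℕ} {X : Type*} [Fintype X] [MeasurableSpace X] (P : Measure (Site ν → X)) :
    Prop :=
  ∃ Φ : Potential ν X, Φ.UniformlyConvergent ∧ IsConditionalDistribution P Φ.gibbsSpec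

/-- The one-point finite-conditional distribution is uniformly nonnull: its positivity is uniform
in the conditioning configuration. -/
def OnePointUniformlyNonnull {ν : ℕ} {X : Type*} [MeasurableSpace X] (P : Measure (Site ν → X)) :
    Prop :=
  ∀ (t : Site ν) (a : X), ∃ ε : ℝ, 0 < ε ∧ ∀ x : FinOuterConfig X {t}, ε ≤ onePoint P t x.val a

/-- Condition (C). Suprema of non-negative quantities are taken in `[0, ∞]`. -/
def CondC {ν : ℕ} {X : Type*} [MeasurableSpace X] (P : Measure (Site ν → X)) : Prop :=
  ∀ (t : Site ν) (a : X),
    Tendsto (fun Λ : OuterVol {t} =>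
      ⨆ (x : FinOuterConfig X {t}) (y : FinOuterConfig X {t})
        (hx : Λ.1 ⊆ x.support) (hy : Λ.1 ⊆ y.support)
        (_ : Finset.restrict₂ (π := fun _ => X) hx x.val =
          Finset.restrict₂ (π := fun _ => X) hy y.val),
        ENNReal.ofReal |onePoint P t x.val a - onePoint P t y.val a|) atTop (𝓝 0)

/-- Condition (D). -/
def CondD {ν : ℕ} {X : Type*} [MeasurableSpace X] (P : Measure (Site ν → X)) : Prop :=
  ∀ (t : Site ν) (a : X),
    Tendsto (fun Λ : OuterVol {t} =>
      ⨆ (J : OuterVol {t}) (_ : J.1.Nonempty) (hJ : Λ.1 ⊆ J.1)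
        (x : Config X J.1) (y : Config X J.1)
        (_ : Finset.restrict₂ (π := fun _ => X) hJ x = Finset.restrict₂ (π := fun _ => X) hJ y),
        ENNReal.ofReal |onePoint P t x a - onePoint P t y a|) atTop (𝓝 0)

/-- Condition (E). -/
def CondE {ν : ℕ} {X : Type*} [MeasurableSpace X] (P : Measure (Site ν → X)) : Prop :=
  ∀ (t : Site ν) (a : X),
    Tendsto (fun Λ : OuterVol {t} =>
      ⨆ (x : FinOuterConfig X {t}) (hx : Λ.1 ⊆ x.support),
        ENNReal.ofReal |onePoint P t x.val a -
          onePoint P t (Finset.restrict₂ (π := fun _ => X) hx x.val) a|) atTop (𝓝 0)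

end GibbsField

/-! Equivalence: (D) is a special case of (C), and comparison with the common restriction bounds the
oscillation in (C) by twice that in (E). The one in (E) is at most that in (D) because forgetting
information averages: `q_t^{z_Λ}` is a convex combination of the `q_t^u`, where `u` lives on the
support of `z` and agrees with `z` on `Λ` (`abs_onePoint_sub_le`).

Gibbs fields: dominated convergence in the tower property exhibits `q_Λ^z(x)` as the average of
`Q_Λ(x)` over the cylinder of `z` (`IsConditionalDistribution.cylProb_eq_setIntegral`). Lower bounds
and quasilocality of the one-point specification, read off from finite partial sums of the energy,
thus pass to `q_t^z`.

Converse: changing `ω` at `t` changes `log P_Γ(ω)` by a difference of two values of `log q_t`, which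
converges uniformly in `ω` as `Γ` grows, by (E) and nonnullness (`exists_logCyl_update_sub_le`). It
remains to cut the formal energy `-log P` into local terms. Replacing the values of `ω` by a fixed
`θ`, site after site in the order of an enumeration, writes `log P_box` as a sum of increments. The
`i`-th one ignores the sites of code below `i` and converges uniformly as the box grows; along
sparse boxes it telescopes into local functions with geometric bounds. A site `t` meets only the
terms with `i` at most its code, so the family is summable at every site, and grouping by support
gives the potential (`exists_potential_of_family`, `exists_potential_energy_sub`). -/

namespace GibbsField

/-! ### Configurations and cylinder probabilities. -/

variable {ν : ℕ} {X : Type*}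

/-- The restriction of a configuration on the whole lattice to the exterior of `Λ`. -/
def outer (Λ : Finset (Site ν)) (ω : Site ν → X) : OuterConfig X Λ := fun s => ω s.1

/-- The probability that the random field agrees with `ω` on `Λ`. -/
noncomputable def cylProb [MeasurableSpace X] (P : Measure (Site ν → X)) (Λ : Finset (Site ν))
    (ω : Site ν → X) : ℝ :=
  P.real {η | ∀ s ∈ Λ, η s = ω s}

lemma glue_of_mem {Λ : Finset (Site ν)} (x : Config X Λ) (y : OuterConfig X Λ) {s : Site ν}
    (h : s ∈ Λ) : glue x y s = x ⟨s, h⟩ := dif_pos h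

lemma glue_of_notMem {Λ : Finset (Site ν)} (x : Config X Λ) (y : OuterConfig X Λ) {s : Site ν}
    (h : s ∉ Λ) : glue x y s = y ⟨s, h⟩ := dif_neg h

lemma glue_single (t : Site ν) (a : X) (ω : Site ν → X) :
    glue (single t a) (outer {t} ω) = Function.update ω t a := by
  funext s
  by_cases h : s = t
  · subst h; simp [glue, single]
  · simp [glue, outer, h]

lemma outer_glue {Λ : Finset (Site ν)} (x : Config X Λ) (y : OuterConfig X Λ) :
    outer Λ (glue x y) = y := by
  funext s
  exact glue_of_notMem x y s.2

lemma restrict_glue {Λ : Finset (Site ν)} (x : Config X Λ) (y : OuterConfig X Λ) :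
    Λ.restrict (glue x y) = x := by
  funext s
  exact glue_of_mem x y s.2

lemma onVol_outer {Λ : Finset (Site ν)} (M : OuterVol Λ) (ω : Site ν → X) :
    (outer Λ ω).onVol M = M.1.restrict ω := rfl

lemma concat_restrict {Λ M : Finset (Site ν)} (x : Config X Λ) (ω : Site ν → X) :
    concat x (M.restrict ω) = (Λ ∪ M).restrict (glue x (outer Λ ω)) := rfl

lemma exists_restrict_eq [Nonempty X] {M : Finset (Site ν)} (z : Config X M) :
    ∃ ω : Site ν → X, M.restrict ω = z :=
  ⟨glue z fun _ => Classical.arbitrary X, restrict_glue _ _⟩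

lemma restrict_eq_iff {M : Finset (Site ν)} {ω η : Site ν → X} :
    M.restrict ω = M.restrict η ↔ ∀ s ∈ M, ω s = η s := by
  simp [funext_iff]

lemma measurable_outer [MeasurableSpace X] (Λ : Finset (Site ν)) :
    Measurable (outer Λ : (Site ν → X) → OuterConfig X Λ) :=
  measurable_pi_lambda _ fun s => measurable_pi_apply s.1

section Measure

variable [MeasurableSpace X] (P : Measure (Site ν → X))

lemma cylProb_congr {Λ : Finset (Site ν)} {ω η : Site ν → X} (h : ∀ s ∈ Λ, ω s = η s) :
    cylProb P Λ ω = cylProb P Λ η := by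
  rw [cylProb, cylProb]
  congr 1
  ext ζ
  exact forall₂_congr fun s hs => by rw [h s hs]

lemma cylProb_nonneg (Λ : Finset (Site ν)) (ω : Site ν → X) : 0 ≤ cylProb P Λ ω :=
  measureReal_nonneg

lemma cylProb_anti [IsProbabilityMeasure P] {Λ M : Finset (Site ν)} (h : Λ ⊆ M)
    (ω : Site ν → X) :
    cylProb P M ω ≤ cylProb P Λ ω :=
  measureReal_mono fun _ hη s hs => hη s (h hs)

lemma nonempty_of_probability (P : Measure (Site ν → X)) [IsProbabilityMeasure P] :
    Nonempty X := by
  obtain ⟨ω⟩ := nonempty_of_isProbabilityMeasure P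
  exact ⟨ω 0⟩

variable [Fintype X] [DiscreteMeasurableSpace X]

lemma measurableSet_cyl (Λ : Finset (Site ν)) (ω : Site ν → X) :
    MeasurableSet {η : Site ν → X | ∀ s ∈ Λ, η s = ω s} := by
  have : {η : Site ν → X | ∀ s ∈ Λ, η s = ω s} = (Λ.restrict (π := fun _ => X)) ⁻¹' {Λ.restrict ω} := by
    ext η; simp [funext_iff]
  rw [this]
  exact Finset.measurable_restrict Λ (measurableSet_singleton _)

lemma fdd_restrict (Λ : Finset (Site ν)) (ω : Site ν → X) :
    fdd P Λ (Λ.restrict ω) = cylProb P Λ ω := by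
  rw [fdd, map_measureReal_apply (Finset.measurable_restrict Λ) (measurableSet_singleton _),
    cylProb]
  congr 1
  ext η
  simp [funext_iff]

lemma finCond_restrict {Λ M : Finset (Site ν)} (ω : Site ν → X) (x : Config X Λ) :
    finCond P Λ (M.restrict ω) x =
      cylProb P (Λ ∪ M) (glue x (outer Λ ω)) / cylProb P M ω := by
  rw [finCond, concat_restrict, fdd_restrict, fdd_restrict]

lemma onePoint_restrict {t : Site ν} {M : Finset (Site ν)} (ω : Site ν → X) (a : X) :
    onePoint P t (M.restrict ω) a =
      cylProb P ({t} ∪ M) (Function.update ω t a) / cylProb P M ω := by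
  rw [onePoint, finCond_restrict, glue_single]

variable {P} in
lemma StrictlyPositive.cylProb_pos (hP : StrictlyPositive P) (Λ : Finset (Site ν))
    (ω : Site ν → X) : 0 < cylProb P Λ ω := by
  rw [← fdd_restrict]; exact hP _ _

variable [IsProbabilityMeasure P]

lemma measureReal_eq_sum_inter (N : Finset (Site ν)) {S : Set (Site ν → X)}
    (hS : MeasurableSet S) :
    P.real S = ∑ u : Config X N, P.real (S ∩ N.restrict ⁻¹' {u}) := by
  rw [← measureReal_biUnion_finset]
  · congr 1
    ext η
    simp
  · intro u _ v _ huv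
    refine Set.disjoint_left.mpr fun η hu hv => huv ?_
    rw [← hu.2, ← hv.2]
  · exact fun u _ => hS.inter (Finset.measurable_restrict N (measurableSet_singleton _))

lemma cylProb_eq_sum {Λ N : Finset (Site ν)} (h : Disjoint Λ N) (ω : Site ν → X) :
    cylProb P Λ ω = ∑ u : Config X N, cylProb P (Λ ∪ N) (glue u (outer N ω)) := by
  rw [cylProb, measureReal_eq_sum_inter P N (measurableSet_cyl Λ ω)]
  refine Finset.sum_congr rfl fun u _ => ?_
  rw [cylProb]
  congr 1
  ext η
  simp only [Set.mem_inter_iff, Set.mem_ofPred_eq, Set.mem_preimage, Set.mem_singleton_iff,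
    Finset.mem_union]
  constructor
  · rintro ⟨h1, rfl⟩ s (hs | hs)
    · rw [glue_of_notMem _ _ (Finset.disjoint_left.mp h hs)]; exact h1 s hs
    · rw [glue_of_mem _ _ hs]; rfl
  · intro h1
    refine ⟨fun s hs => ?_, ?_⟩
    · rw [h1 s (Or.inl hs), glue_of_notMem _ _ (Finset.disjoint_left.mp h hs)]; rfl
    · funext s
      exact (h1 s (Or.inr s.2)).trans (glue_of_mem _ _ s.2)

end Measure

end GibbsField

/-! ### Equivalence of (C), (D) and (E). -/

namespace GibbsField

variable {ν : ℕ} {X : Type*} [MeasurableSpace X] (P : Measure (Site ν → X))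

/-- The oscillation appearing in condition (C). -/
noncomputable def oscC (t : Site ν) (a : X) (Λ : OuterVol {t}) : ENNReal :=
  ⨆ (x : FinOuterConfig X {t}) (y : FinOuterConfig X {t})
    (hx : Λ.1 ⊆ x.support) (hy : Λ.1 ⊆ y.support)
    (_ : Finset.restrict₂ (π := fun _ => X) hx x.val =
      Finset.restrict₂ (π := fun _ => X) hy y.val),
    ENNReal.ofReal |onePoint P t x.val a - onePoint P t y.val a|

/-- The oscillation appearing in condition (D). -/
noncomputable def oscD (t : Site ν) (a : X) (Λ : OuterVol {t}) : ENNReal :=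
  ⨆ (J : OuterVol {t}) (_ : J.1.Nonempty) (hJ : Λ.1 ⊆ J.1)
    (x : Config X J.1) (y : Config X J.1)
    (_ : Finset.restrict₂ (π := fun _ => X) hJ x = Finset.restrict₂ (π := fun _ => X) hJ y),
    ENNReal.ofReal |onePoint P t x a - onePoint P t y a|

/-- The oscillation appearing in condition (E). -/
noncomputable def oscE (t : Site ν) (a : X) (Λ : OuterVol {t}) : ENNReal :=
  ⨆ (x : FinOuterConfig X {t}) (hx : Λ.1 ⊆ x.support),
    ENNReal.ofReal |onePoint P t x.val a -
      onePoint P t (Finset.restrict₂ (π := fun _ => X) hx x.val) a|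

lemma le_oscC {t : Site ν} {a : X} {Λ : OuterVol {t}} (x y : FinOuterConfig X {t})
    (hx : Λ.1 ⊆ x.support) (hy : Λ.1 ⊆ y.support)
    (h : Finset.restrict₂ (π := fun _ => X) hx x.val =
      Finset.restrict₂ (π := fun _ => X) hy y.val) :
    ENNReal.ofReal |onePoint P t x.val a - onePoint P t y.val a| ≤ oscC P t a Λ :=
  le_iSup_of_le x <| le_iSup_of_le y <| le_iSup_of_le hx <| le_iSup_of_le hy <|
    le_iSup_of_le h le_rfl

lemma le_oscD {t : Site ν} {a : X} {Λ J : OuterVol {t}} (hne : J.1.Nonempty) (hJ : Λ.1 ⊆ J.1)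
    (x y : Config X J.1)
    (h : Finset.restrict₂ (π := fun _ => X) hJ x = Finset.restrict₂ (π := fun _ => X) hJ y) :
    ENNReal.ofReal |onePoint P t x a - onePoint P t y a| ≤ oscD P t a Λ :=
  le_iSup_of_le J <| le_iSup_of_le hne <| le_iSup_of_le hJ <| le_iSup_of_le x <|
    le_iSup_of_le y <| le_iSup_of_le h le_rfl

lemma le_oscE {t : Site ν} {a : X} {Λ : OuterVol {t}} (x : FinOuterConfig X {t})
    (hx : Λ.1 ⊆ x.support) :
    ENNReal.ofReal |onePoint P t x.val a -
      onePoint P t (Finset.restrict₂ (π := fun _ => X) hx x.val) a| ≤ oscE P t a Λ :=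
  le_iSup_of_le x <| le_iSup_of_le hx le_rfl

lemma oscD_le_oscC (t : Site ν) (a : X) (Λ : OuterVol {t}) : oscD P t a Λ ≤ oscC P t a Λ := by
  refine iSup_le fun J => iSup_le fun hne => iSup_le fun hJ => iSup_le fun x => iSup_le fun y =>
    iSup_le fun h => ?_
  exact le_oscC P ⟨J.1, hne, J.2, x⟩ ⟨J.1, hne, J.2, y⟩ hJ hJ h

/-- Triangle inequality through the value at the common restriction to `Λ`. -/
lemma oscC_le_oscE (t : Site ν) (a : X) (Λ : OuterVol {t}) :
    oscC P t a Λ ≤ oscE P t a Λ + oscE P t a Λ := by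
  refine iSup_le fun x => iSup_le fun y => iSup_le fun hx => iSup_le fun hy => iSup_le fun h => ?_
  refine le_trans ?_ (add_le_add (le_oscE P x hx) (le_oscE P y hy))
  rw [← ENNReal.ofReal_add (abs_nonneg _) (abs_nonneg _), h]
  refine ENNReal.ofReal_le_ofReal ?_
  rw [abs_sub_comm (onePoint P t y.val a)]
  exact abs_sub_le _ _ _

section Averaging

variable [Fintype X] [DiscreteMeasurableSpace X] [IsProbabilityMeasure P] {P}

/-- A one-point conditional probability is an average of the one-point conditional probabilities
given more information. -/
lemma abs_onePoint_sub_le (hP : StrictlyPositive P) {t : Site ν} {Λ V : Finset (Site ν)}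
    (hΛV : Λ ⊆ V) (htV : t ∉ V) (ω : Site ν → X) (a : X) (q c : ℝ)
    (h : ∀ η : Site ν → X, (∀ s ∈ Λ, η s = ω s) → |onePoint P t (V.restrict η) a - q| ≤ c) :
    |onePoint P t (Λ.restrict ω) a - q| ≤ c := by
  have hW := hP.cylProb_pos
  have hd : Disjoint Λ (V \ Λ) := Finset.disjoint_sdiff
  have hd' : Disjoint ({t} ∪ Λ) (V \ Λ) := by
    rw [Finset.disjoint_union_left]
    exact ⟨by simp [htV], hd⟩
  have hU : Λ ∪ V \ Λ = V := Finset.union_sdiff_of_subset hΛV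
  have hU' : {t} ∪ Λ ∪ V \ Λ = {t} ∪ V := by rw [Finset.union_assoc, hU]
  have e1 := cylProb_eq_sum P hd ω
  have e2 := cylProb_eq_sum P hd' (Function.update ω t a)
  rw [hU] at e1
  rw [hU'] at e2
  -- After clearing the denominator `P_Λ(ω)`, both sides are sums over the configurations `u` on `V
  -- \ Λ`, compared term by term.
  rw [onePoint_restrict, div_sub' (hW _ _).ne', abs_div, abs_of_pos (hW Λ ω), div_le_iff₀ (hW _ _),
    e2, e1, Finset.mul_sum, Finset.sum_mul, ← Finset.sum_sub_distrib]
  refine (Finset.abs_sum_le_sum_abs _ _).trans (Finset.sum_le_sum fun u _ => ?_)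
  set η := glue u (outer (V \ Λ) ω) with hη
  have hupd : cylProb P ({t} ∪ V) (glue u (outer (V \ Λ) (Function.update ω t a))) =
      cylProb P ({t} ∪ V) (Function.update η t a) := by
    refine cylProb_congr P fun s hs => ?_
    by_cases hst : s = t
    · subst hst
      rw [glue_of_notMem _ _ (by simp [htV])]
      simp [outer]
    · by_cases hsV : s ∈ V \ Λ
      · simp [hst, hη, glue_of_mem _ _ hsV]
      · simp [hst, hη, glue_of_notMem _ _ hsV, outer]
  have := h η fun s hs => by
    rw [hη, glue_of_notMem _ _ (fun h' => (Finset.mem_sdiff.mp h').2 hs)]; rfl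
  rw [onePoint_restrict, div_sub' (hW _ _).ne', abs_div, abs_of_pos (hW V η),
    div_le_iff₀ (hW _ _)] at this
  rw [hupd]
  exact this

lemma oscE_le_oscD (hP : StrictlyPositive P) (t : Site ν) (a : X) (Λ : OuterVol {t}) :
    oscE P t a Λ ≤ oscD P t a Λ := by
  refine iSup_le fun x => iSup_le fun hx => ?_
  rcases eq_or_ne (oscD P t a Λ) ⊤ with htop | htop
  · rw [htop]; exact le_top
  rw [ENNReal.ofReal_le_iff_le_toReal htop, abs_sub_comm]
  have := nonempty_of_probability P
  obtain ⟨ω, hω⟩ := exists_restrict_eq x.val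
  have : Finset.restrict₂ (π := fun _ => X) hx x.val = Λ.1.restrict ω := by rw [← hω]; rfl
  rw [this]
  refine abs_onePoint_sub_le hP hx (Finset.disjoint_singleton_left.mp x.disjoint) ω a _ _
    fun η hη => ?_
  rw [← ENNReal.ofReal_le_iff_le_toReal htop]
  -- The common volume is the support of `x`, non-empty even when `Λ` is empty, as (D) requires.
  refine le_oscD P (J := ⟨x.support, x.disjoint⟩) x.nonempty hx _ _ ?_
  rw [this]
  funext s
  exact hη s s.2

lemma condC_iff_condD (hP : StrictlyPositive P) : CondC P ↔ CondD P := by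
  constructor <;> intro h t a
  · exact tendsto_of_tendsto_of_tendsto_of_le_of_le tendsto_const_nhds (h t a)
      (fun _ => bot_le) (oscD_le_oscC P t a)
  · have h' : Tendsto (oscD P t a) atTop (𝓝 0) := h t a
    refine tendsto_of_tendsto_of_tendsto_of_le_of_le tendsto_const_nhds
      (by simpa using h'.add h') (fun _ => bot_le)
      fun Λ => (oscC_le_oscE P t a Λ).trans ?_
    exact add_le_add (oscE_le_oscD hP t a Λ) (oscE_le_oscD hP t a Λ)

lemma condC_iff_condE (hP : StrictlyPositive P) : CondC P ↔ CondE P := by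
  constructor <;> intro h t a
  · exact tendsto_of_tendsto_of_tendsto_of_le_of_le tendsto_const_nhds (h t a)
      (fun _ => bot_le) fun Λ => (oscE_le_oscD hP t a Λ).trans (oscD_le_oscC P t a Λ)
  · have h' : Tendsto (oscE P t a) atTop (𝓝 0) := h t a
    exact tendsto_of_tendsto_of_tendsto_of_le_of_le tendsto_const_nhds
      (by simpa using h'.add h') (fun _ => bot_le) (oscC_le_oscE P t a)

end Averaging

end GibbsField

/-! ### Gibbs fields are strictly positive, uniformly nonnull and satisfy (C). -/

namespace GibbsField

/-- The finite set of the sites whose code is less than `n`. -/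
noncomputable def box (ν n : ℕ) : Finset (Site ν) :=
  (Finset.range n).preimage Encodable.encode Encodable.encode_injective.injOn

lemma mem_box {ν n : ℕ} {s : Site ν} : s ∈ box ν n ↔ Encodable.encode s < n := by
  simp [box]

lemma monotone_box (ν : ℕ) : Monotone (box ν) := fun _ _ h _ hs =>
  mem_box.mpr ((mem_box.mp hs).trans_le h)

lemma exists_mem_box {ν : ℕ} (s : Site ν) : ∃ n, s ∈ box ν n :=
  ⟨_, mem_box.mpr (Nat.lt_succ_self _)⟩

variable {ν : ℕ} {X : Type*}

section Softmax

/-- Numerator and normalizer each change by a factor of at most `e^δ`; since the weights are at most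
`1`, the relative error `e^{2δ} - 1` is also an absolute one. -/
lemma exp_div_sum_sub_le {ι : Type*} [Fintype ι] {u v : ι → ℝ} {δ : ℝ}
    (h : ∀ j, |u j - v j| ≤ δ) (i : ι) :
    Real.exp (-u i) / ∑ j, Real.exp (-u j) - Real.exp (-v i) / ∑ j, Real.exp (-v j) ≤
      Real.exp (2 * δ) - 1 := by
  have : Nonempty ι := ⟨i⟩
  have hu : 0 < ∑ j, Real.exp (-u j) :=
    Finset.sum_pos (fun _ _ => Real.exp_pos _) Finset.univ_nonempty
  have hv : 0 < ∑ j, Real.exp (-v j) :=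
    Finset.sum_pos (fun _ _ => Real.exp_pos _) Finset.univ_nonempty
  have h1 : Real.exp (-u i) ≤ Real.exp δ * Real.exp (-v i) := by
    rw [← Real.exp_add]
    exact Real.exp_le_exp.mpr (by linarith [(abs_le.mp (h i)).1])
  have h2 : ∑ j, Real.exp (-v j) ≤ Real.exp δ * ∑ j, Real.exp (-u j) := by
    rw [Finset.mul_sum]
    refine Finset.sum_le_sum fun j _ => ?_
    rw [← Real.exp_add]
    exact Real.exp_le_exp.mpr (by linarith [(abs_le.mp (h j)).2])
  have h3 : Real.exp (-u i) / ∑ j, Real.exp (-u j) ≤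
      Real.exp (2 * δ) * (Real.exp (-v i) / ∑ j, Real.exp (-v j)) := by
    rw [← mul_div_assoc, div_le_div_iff₀ hu hv, two_mul, Real.exp_add]
    calc _ ≤ (Real.exp δ * Real.exp (-v i)) * (Real.exp δ * ∑ j, Real.exp (-u j)) := by
          gcongr
      _ = _ := by ring
  have h4 : Real.exp (-v i) / ∑ j, Real.exp (-v j) ≤ 1 := by
    rw [div_le_one hv]
    exact Finset.single_le_sum (fun j _ => (Real.exp_pos (-v j)).le) (Finset.mem_univ i)
  have h5 : 1 ≤ Real.exp (2 * δ) :=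
    Real.one_le_exp (by linarith [(abs_nonneg _).trans (h i)])
  nlinarith

lemma abs_exp_div_sum_sub_le {ι : Type*} [Fintype ι] {u v : ι → ℝ} {δ : ℝ}
    (h : ∀ j, |u j - v j| ≤ δ) (i : ι) :
    |Real.exp (-u i) / ∑ j, Real.exp (-u j) - Real.exp (-v i) / ∑ j, Real.exp (-v j)| ≤
      Real.exp (2 * δ) - 1 :=
  abs_sub_le_iff.mpr
    ⟨exp_div_sum_sub_le h i, exp_div_sum_sub_le (fun j => by rw [abs_sub_comm]; exact h j) i⟩

lemma le_exp_div_sum {ι : Type*} [Fintype ι] {u : ι → ℝ} {C : ℝ} (h : ∀ j, |u j| ≤ C) (i : ι) :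
    Real.exp (-C) / (Fintype.card ι * Real.exp C) ≤ Real.exp (-u i) / ∑ j, Real.exp (-u j) := by
  have : Nonempty ι := ⟨i⟩
  have hu : 0 < ∑ j, Real.exp (-u j) :=
    Finset.sum_pos (fun _ _ => Real.exp_pos _) Finset.univ_nonempty
  refine div_le_div₀ (Real.exp_pos _).le
    (Real.exp_le_exp.mpr (neg_le_neg (abs_le.mp (h i)).2)) hu ?_
  calc ∑ j, Real.exp (-u j) ≤ ∑ _j : ι, Real.exp C :=
        Finset.sum_le_sum fun j _ => Real.exp_le_exp.mpr (neg_le.mp (abs_le.mp (h j)).1)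
    _ = _ := by simp

end Softmax

section Energy

variable (Φ : Potential ν X)

lemma energy_singleton (t : Site ν) (xbar : OuterConfig X {t}) (x : Config X {t}) :
    Φ.energy {t} xbar x = ∑' K : OuterVol {t}, Φ.term x xbar {t} K := by
  have : (({t} : Finset (Site ν)).powerset.filter Finset.Nonempty) = {{t}} := by
    ext J
    simp only [Finset.mem_filter, Finset.mem_powerset, Finset.mem_singleton,
      Finset.subset_singleton_iff]
    constructor
    · rintro ⟨rfl | h, hne⟩
      · simp at hne
      · exact h
    · rintro rfl
      exact ⟨Or.inr rfl, Finset.singleton_nonempty t⟩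
  rw [Potential.energy, this, Finset.sum_singleton]

lemma config_singleton_eq (t : Site ν) (x : Config X {t}) :
    x = single t (x ⟨t, Finset.mem_singleton_self t⟩) := by
  funext ⟨s, hs⟩
  obtain rfl := Finset.mem_singleton.mp hs
  rfl

lemma gibbsSpec_pos [Fintype X] [Nonempty X] (Λ : Finset (Site ν)) (xbar : OuterConfig X Λ)
    (x : Config X Λ) : 0 < Φ.gibbsSpec Λ xbar x :=
  div_pos (Real.exp_pos _) (Finset.sum_pos (fun _ _ => Real.exp_pos _) Finset.univ_nonempty)

variable {Φ}

lemma term_congr {Λ : Finset (Site ν)} (x : Config X Λ) {xbar ybar : OuterConfig X Λ}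
    (J : Finset (Site ν)) (hJ : J ⊆ Λ) (K : OuterVol Λ) (h : ∀ s, s.1 ∈ K.1 → xbar s = ybar s) :
    Φ.term x xbar J K = Φ.term x ybar J K := by
  unfold Potential.term
  congr 1
  rw [restrict_eq_iff]
  intro s hs
  by_cases hsΛ : s ∈ Λ
  · rw [glue_of_mem _ _ hsΛ, glue_of_mem _ _ hsΛ]
  · rw [glue_of_notMem _ _ hsΛ, glue_of_notMem _ _ hsΛ]
    exact h ⟨s, hsΛ⟩ ((Finset.mem_union.mp hs).resolve_left fun h' => hsΛ (hJ h'))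

/-- Some finite partial sum is within `1` of the energy for all `xbar`, and it takes only finitely
many values. -/
lemma UniformlyConvergent.exists_energy_bound [Fintype X] (hΦ : Φ.UniformlyConvergent)
    (t : Site ν) : ∃ C, ∀ xbar (x : Config X {t}), |Φ.energy {t} xbar x| ≤ C := by
  have key : ∀ a : X, ∃ C, ∀ xbar, |Φ.energy {t} xbar (single t a)| ≤ C := by
    intro a
    obtain ⟨F, hF⟩ := ((Metric.tendstoUniformly_iff.mp (hΦ t a).2) 1 one_pos).exists
    refine ⟨1 + ∑ K ∈ F, ∑ c : Config X ({t} ∪ K.1), |Φ _ c|, fun xbar => ?_⟩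
    have h1 := hF xbar
    rw [← energy_singleton, Real.dist_eq] at h1
    have h2 : |∑ K ∈ F, Φ.term (single t a) xbar {t} K| ≤
        ∑ K ∈ F, ∑ c : Config X ({t} ∪ K.1), |Φ _ c| :=
      (Finset.abs_sum_le_sum_abs _ _).trans <| Finset.sum_le_sum fun K _ =>
        Finset.single_le_sum (f := fun c : Config X ({t} ∪ K.1) => |Φ _ c|)
          (fun _ _ => abs_nonneg _) (Finset.mem_univ _)
    have h3 := abs_add_le (Φ.energy {t} xbar (single t a) -
      ∑ K ∈ F, Φ.term (single t a) xbar {t} K) (∑ K ∈ F, Φ.term (single t a) xbar {t} K)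
    rw [sub_add_cancel] at h3
    linarith
  choose C hC using key
  refine ⟨∑ a, |C a|, fun xbar x => ?_⟩
  rw [config_singleton_eq t x]
  exact ((hC _ xbar).trans (le_abs_self _)).trans
    (Finset.single_le_sum (f := fun a => |C a|) (fun _ _ => abs_nonneg _) (Finset.mem_univ _))

lemma UniformlyConvergent.exists_energy_oscillation [Fintype X] (hΦ : Φ.UniformlyConvergent)
    (t : Site ν) {δ : ℝ} (hδ : 0 < δ) : ∃ Λ : OuterVol {t}, ∀ xbar ybar : OuterConfig X {t},
      (∀ s, s.1 ∈ Λ.1 → xbar s = ybar s) →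
      ∀ x : Config X {t}, |Φ.energy {t} xbar x - Φ.energy {t} ybar x| ≤ δ := by
  have key : ∀ a : X, ∃ F : Finset (OuterVol {t}), ∀ xbar,
      |Φ.energy {t} xbar (single t a) - ∑ K ∈ F, Φ.term (single t a) xbar {t} K| < δ / 2 := by
    intro a
    obtain ⟨F, hF⟩ := ((Metric.tendstoUniformly_iff.mp (hΦ t a).2) (δ / 2) (half_pos hδ)).exists
    refine ⟨F, fun xbar => ?_⟩
    have h1 := hF xbar
    rwa [← energy_singleton, Real.dist_eq] at h1
  choose F hF using key
  -- The chosen partial sums only see the sites in this union, so the two energies differ only by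
  -- two tails of size `δ / 2`.
  refine ⟨⟨Finset.univ.biUnion fun a => (F a).biUnion fun K => K.1, ?_⟩,
    fun xbar ybar h x => ?_⟩
  · simp only [Finset.disjoint_biUnion_right]
    exact fun a _ K _ => K.2
  · rw [config_singleton_eq t x]
    set a := x ⟨t, Finset.mem_singleton_self t⟩
    have h1 := hF a xbar
    have h2 := hF a ybar
    have h3 : ∑ K ∈ F a, Φ.term (single t a) xbar {t} K =
        ∑ K ∈ F a, Φ.term (single t a) ybar {t} K :=
      Finset.sum_congr rfl fun K hK => term_congr _ _ subset_rfl K fun s hs =>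
        h s (Finset.mem_biUnion.mpr ⟨a, Finset.mem_univ a, Finset.mem_biUnion.mpr ⟨K, hK, hs⟩⟩)
    rw [h3, abs_lt] at h1
    rw [abs_lt] at h2
    rw [abs_le]
    constructor <;> linarith [h1.1, h1.2, h2.1, h2.2]

end Energy

section Averaging

lemma finCond_nonneg [MeasurableSpace X] {P : Measure (Site ν → X)} {Λ M : Finset (Site ν)} (z : Config X M)
    (x : Config X Λ) :
    0 ≤ finCond P Λ z x :=
  div_nonneg measureReal_nonneg measureReal_nonneg

variable [Fintype X] [MeasurableSpace X] [DiscreteMeasurableSpace X] {P : Measure (Site ν → X)}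
  [IsProbabilityMeasure P] {Q : CondSystem ν X}

lemma finCond_le_one {Λ M : Finset (Site ν)} (hd : Disjoint Λ M) (z : Config X M)
    (x : Config X Λ) : finCond P Λ z x ≤ 1 := by
  have := nonempty_of_probability P
  obtain ⟨ω, rfl⟩ := exists_restrict_eq z
  rw [finCond_restrict]
  refine div_le_one_of_le₀ ?_ (cylProb_nonneg P _ _)
  refine (cylProb_anti P Finset.subset_union_right _).trans_eq (cylProb_congr P fun s hs => ?_)
  exact glue_of_notMem _ _ (Finset.disjoint_right.mp hd hs)

/-- If `P_Λ(x) = 0`, every `q_Λ^z(x)` vanishes (also where `P_M(z) = 0`, as division by zero gives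
`0`), so the limit `Q` would vanish at some `xbar`. -/
lemma IsConditionalDistribution.strictlyPositive (h : IsConditionalDistribution P Q)
    (hQ : ∀ Λ xbar x, 0 < Q Λ xbar x) : StrictlyPositive P := by
  intro Λ x
  have := nonempty_of_probability P
  refine lt_of_le_of_ne measureReal_nonneg fun h0 => ?_
  have hmap : IsProbabilityMeasure (outerMarginal P Λ) :=
    Measure.isProbabilityMeasure_map (measurable_outer Λ).aemeasurable
  obtain ⟨xbar, hx⟩ := (h.2 Λ (fun n => ⟨box ν n \ Λ, Finset.disjoint_sdiff⟩)
    (fun m n hmn => Finset.sdiff_subset_sdiff (monotone_box ν hmn) subset_rfl)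
    (fun s hs => (exists_mem_box s).imp fun n hn => Finset.mem_sdiff.mpr ⟨hn, hs⟩)).exists
  have h1 := hx x
  have h2 : ∀ M : OuterVol Λ, finCond P Λ (xbar.onVol M) x = 0 := by
    intro M
    rw [← outer_glue x xbar, onVol_outer, finCond_restrict, outer_glue]
    refine div_eq_zero_iff.mpr (Or.inl (le_antisymm ?_ (cylProb_nonneg P _ _)))
    refine (cylProb_anti P Finset.subset_union_left _).trans ?_
    rw [← fdd_restrict, restrict_glue, ← h0]
  simp only [h2] at h1
  exact (hQ Λ xbar x).ne (tendsto_nhds_unique tendsto_const_nhds h1)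

/-- The law of total probability over configurations on `N`. The value does not depend on `N`, which
allows `N` to grow to `Λᶜ`. -/
lemma setIntegral_finCond (hP : StrictlyPositive P) {Λ M N : Finset (Site ν)}
    (hd : Disjoint Λ N) (hMN : M ⊆ N) (ω : Site ν → X) (x : Config X Λ) :
    ∫ η in {η | ∀ s ∈ M, η s = ω s}, finCond P Λ (N.restrict η) x ∂P =
      cylProb P (Λ ∪ M) (glue x (outer Λ ω)) := by
  have := nonempty_of_probability P
  set T : Set (Config X N) := {u | ∀ s (hs : s ∈ M), u ⟨s, hMN hs⟩ = ω s} with hT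
  set g : Config X N → ℝ := T.indicator fun u => finCond P Λ u x with hg
  have hm := Finset.measurable_restrict (X := fun _ : Site ν => X) N
  have e1 : ∫ η in {η | ∀ s ∈ M, η s = ω s}, finCond P Λ (N.restrict η) x ∂P =
      ∫ η, g (N.restrict η) ∂P := by
    rw [← integral_indicator (measurableSet_cyl M ω)]
    rfl
  rw [e1, ← integral_map (f := g) hm.aemeasurable
    (measurable_of_countable g).aestronglyMeasurable, integral_fintype (Integrable.of_finite),
    cylProb, measureReal_eq_sum_inter P N (measurableSet_cyl _ _)]
  refine Finset.sum_congr rfl fun u _ => ?_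
  obtain ⟨ζ, rfl⟩ := exists_restrict_eq u
  have e2 : (P.map N.restrict).real {N.restrict ζ} = cylProb P N ζ := fdd_restrict P N ζ
  rw [e2, smul_eq_mul]
  by_cases hζ : N.restrict ζ ∈ T
  · rw [hg, Set.indicator_of_mem hζ, finCond_restrict, mul_div_cancel₀ _ (hP.cylProb_pos _ _).ne',
      cylProb]
    congr 1
    ext η
    simp only [Set.mem_inter_iff, Set.mem_ofPred_eq, Set.mem_preimage, Set.mem_singleton_iff,
      Finset.mem_union, restrict_eq_iff]
    constructor
    · intro h
      refine ⟨?_, fun s hs => ?_⟩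
      · rintro s (hs | hs)
        · rw [h s (Or.inl hs), glue_of_mem _ _ hs, glue_of_mem _ _ hs]
        · have hsΛ := Finset.disjoint_right.mp hd (hMN hs)
          rw [h s (Or.inr (hMN hs)), glue_of_notMem _ _ hsΛ, glue_of_notMem _ _ hsΛ]
          exact hζ s hs
      · rw [h s (Or.inr hs), glue_of_notMem _ _ (Finset.disjoint_right.mp hd hs)]
        rfl
    · rintro ⟨h1, h2⟩ s (hs | hs)
      · rw [h1 s (Or.inl hs), glue_of_mem _ _ hs, glue_of_mem _ _ hs]
      · rw [h2 s hs, glue_of_notMem _ _ (Finset.disjoint_right.mp hd hs)]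
        rfl
  · rw [hg, Set.indicator_of_notMem hζ, mul_zero]
    symm
    convert measureReal_empty
    ext η
    simp only [Set.mem_inter_iff, Set.mem_ofPred_eq, Set.mem_preimage, Set.mem_singleton_iff,
      Set.mem_empty_iff_false, iff_false, restrict_eq_iff, Finset.mem_union]
    rintro ⟨h1, h2⟩
    refine hζ fun s hs => ?_
    have := h1 s (Or.inr hs)
    rw [glue_of_notMem _ _ (Finset.disjoint_right.mp hd (hMN hs)), h2 s (hMN hs)] at this
    exact this

lemma IsConditionalDistribution.cylProb_eq_setIntegral (h : IsConditionalDistribution P Q)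
    (hP : StrictlyPositive P) {Λ M : Finset (Site ν)} (hd : Disjoint Λ M) (ω : Site ν → X)
    (x : Config X Λ) :
    IntegrableOn (fun η => Q Λ (outer Λ η) x) {η | ∀ s ∈ M, η s = ω s} P ∧
    cylProb P (Λ ∪ M) (glue x (outer Λ ω)) =
      ∫ η in {η | ∀ s ∈ M, η s = ω s}, Q Λ (outer Λ η) x ∂P := by
  -- Every volume contains `M`, so the integrals over the cylinder on `M` form a constant sequence.
  set N : ℕ → OuterVol Λ := fun n => ⟨M ∪ box ν n \ Λ,
    Finset.disjoint_union_right.mpr ⟨hd, Finset.disjoint_sdiff⟩⟩ with hN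
  have h1 := h.2 Λ N
    (fun m n hmn => Finset.union_subset_union subset_rfl
      (Finset.sdiff_subset_sdiff (monotone_box ν hmn) subset_rfl))
    (fun s hs => (exists_mem_box s).imp fun n hn =>
      Finset.mem_union_right _ (Finset.mem_sdiff.mpr ⟨hn, hs⟩))
  have h2 : ∀ᵐ η ∂P, Tendsto (fun n => finCond P Λ ((N n).1.restrict η) x) atTop
      (𝓝 (Q Λ (outer Λ η) x)) :=
    (ae_of_ae_map (measurable_outer Λ).aemeasurable h1).mono fun η hη => hη x
  have hmeas : ∀ n, AEStronglyMeasurable (fun η => finCond P Λ ((N n).1.restrict η) x) P :=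
    fun n => ((measurable_of_countable fun u : Config X (N n).1 => finCond P Λ u x).comp
      (Finset.measurable_restrict _)).aestronglyMeasurable
  have hbound : ∀ n (η : Site ν → X), ‖finCond P Λ ((N n).1.restrict η) x‖ ≤ 1 := fun n η => by
    rw [Real.norm_of_nonneg (finCond_nonneg _ _)]
    exact finCond_le_one (N n).2 _ _
  constructor
  · refine (Integrable.of_bound (aestronglyMeasurable_of_tendsto_ae atTop hmeas h2) 1
      (Eventually.of_forall fun η => ?_)).integrableOn
    rw [Real.norm_of_nonneg ((h.1 Λ _).1 x), ← (h.1 Λ (outer Λ η)).2]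
    exact Finset.single_le_sum (fun y _ => (h.1 Λ (outer Λ η)).1 y) (Finset.mem_univ x)
  · have h3 := tendsto_integral_of_dominated_convergence (μ := P.restrict {η | ∀ s ∈ M, η s = ω s})
      (fun _ => (1 : ℝ)) (fun n => (hmeas n).restrict) (integrable_const _)
      (fun n => Eventually.of_forall (hbound n)) (ae_restrict_of_ae h2)
    simp only [fun n => setIntegral_finCond hP (N n).2
      (Finset.subset_union_left : M ⊆ (N n).1) ω x] at h3
    exact tendsto_nhds_unique tendsto_const_nhds h3

lemma IsGibbs.strictlyPositive (h : IsGibbs P) : StrictlyPositive P := by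
  have := nonempty_of_probability P
  obtain ⟨Φ, -, hΦ⟩ := h
  exact hΦ.strictlyPositive (gibbsSpec_pos Φ)

lemma IsGibbs.onePointUniformlyNonnull (h : IsGibbs P) : OnePointUniformlyNonnull P := by
  have hP := h.strictlyPositive
  have := nonempty_of_probability P
  obtain ⟨Φ, hU, hΦ⟩ := h
  intro t a
  obtain ⟨C, hC⟩ := UniformlyConvergent.exists_energy_bound hU t
  refine ⟨Real.exp (-C) / (Fintype.card (Config X {t}) * Real.exp C),
    div_pos (Real.exp_pos _) (mul_pos (by exact_mod_cast Fintype.card_pos) (Real.exp_pos _)),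
    fun x => ?_⟩
  obtain ⟨ω, hω⟩ := exists_restrict_eq x.val
  obtain ⟨hi, he⟩ := hΦ.cylProb_eq_setIntegral hP x.disjoint ω (single t a)
  rw [← hω, onePoint, finCond_restrict, le_div_iff₀ (hP.cylProb_pos _ _), he, mul_comm]
  exact setIntegral_ge_of_const_le (measurableSet_cyl _ _) (measure_ne_top _ _)
    (fun η _ => le_exp_div_sum (hC (outer {t} η)) (single t a)) hi

lemma IsGibbs.condC (h : IsGibbs P) : CondC P := by
  have hP := h.strictlyPositive
  have := nonempty_of_probability P
  obtain ⟨Φ, hU, hΦ⟩ := h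
  intro t a
  change Tendsto (oscC P t a) atTop (𝓝 0)
  rw [ENNReal.tendsto_nhds_zero]
  intro ε hε
  obtain ⟨ε', hε', hle⟩ : ∃ ε' : ℝ, 0 < ε' ∧ ENNReal.ofReal ε' ≤ ε := by
    rcases eq_or_ne ε ⊤ with rfl | hne
    · exact ⟨1, one_pos, le_top⟩
    · exact ⟨ε.toReal, ENNReal.toReal_pos hε.ne' hne, ENNReal.ofReal_toReal_le⟩
  obtain ⟨δ, hδ, hδε⟩ : ∃ δ : ℝ, 0 < δ ∧ 2 * (Real.exp (2 * δ) - 1) ≤ ε' := by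
    -- Solves `2 (e^{2δ} - 1) = ε'`.
    refine ⟨Real.log (1 + ε' / 2) / 2, half_pos (Real.log_pos (by linarith)), ?_⟩
    rw [mul_div_cancel₀ _ two_ne_zero, Real.exp_log (by linarith)]
    linarith
  obtain ⟨Λ₀, hΛ₀⟩ := UniformlyConvergent.exists_energy_oscillation hU t hδ
  filter_upwards [eventually_ge_atTop Λ₀] with Λ hΛ
  refine iSup_le fun x => iSup_le fun y => iSup_le fun hx => iSup_le fun hy => iSup_le fun hxy =>
    (ENNReal.ofReal_le_ofReal ?_).trans hle
  obtain ⟨ω, hω⟩ := exists_restrict_eq x.val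
  -- Both conditional probabilities are compared with one value of the specification, at `ω`
  -- extending `x`: on the cylinder of `z` the integrand stays close to it.
  have key : ∀ z : FinOuterConfig X {t}, ∀ hz : Λ.1 ⊆ z.support,
      Finset.restrict₂ (π := fun _ => X) hz z.val = Λ.1.restrict ω →
      |onePoint P t z.val a - Φ.gibbsSpec {t} (outer {t} ω) (single t a)| ≤
        Real.exp (2 * δ) - 1 := by
    intro z hz hzω
    obtain ⟨ζ, hζ⟩ := exists_restrict_eq z.val
    obtain ⟨hi, he⟩ := hΦ.cylProb_eq_setIntegral hP z.disjoint ζ (single t a)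
    have hpos := hP.cylProb_pos z.support ζ
    set c := Φ.gibbsSpec {t} (outer {t} ω) (single t a)
    have hsub : ∫ η in {η | ∀ s ∈ z.support, η s = ζ s},
        (Φ.gibbsSpec {t} (outer {t} η) (single t a) - c) ∂P =
        cylProb P ({t} ∪ z.support) (glue (single t a) (outer {t} ζ)) -
          cylProb P z.support ζ * c := by
      rw [integral_sub hi (integrable_const _), ← he, setIntegral_const, smul_eq_mul]
      rfl
    have hb := norm_setIntegral_le_of_norm_le_const (μ := P)
      (s := {η | ∀ s ∈ z.support, η s = ζ s}) (C := Real.exp (2 * δ) - 1)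
      (f := fun η => Φ.gibbsSpec {t} (outer {t} η) (single t a) - c) (measure_lt_top _ _) <| by
        intro η hη
        refine abs_exp_div_sum_sub_le (hΛ₀ _ _ fun s hs => ?_) _
        have h1 : ζ s.1 = ω s.1 := by
          rw [← hζ] at hzω
          exact congrFun hzω ⟨s.1, hΛ hs⟩
        exact (hη s.1 (hz (hΛ hs))).trans h1
    rw [hsub, Real.norm_eq_abs] at hb
    rw [← hζ, onePoint, finCond_restrict, div_sub' hpos.ne', abs_div, abs_of_pos hpos,
      div_le_iff₀ hpos]
    exact hb
  have hx' : Finset.restrict₂ (π := fun _ => X) hx x.val = Λ.1.restrict ω := by rw [← hω]; rfl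
  have h1 := key x hx hx'
  have h2 := key y hy (hxy ▸ hx')
  rw [abs_sub_comm] at h2
  linarith [abs_sub_le (onePoint P t x.val a) (Φ.gibbsSpec {t} (outer {t} ω) (single t a))
    (onePoint P t y.val a)]

end Averaging

end GibbsField

/-! ### Potentials from summable families of local functions. -/

namespace GibbsField

section PotentialOfFamily

variable {ν : ℕ} {X : Type*} {ι : Type*}

lemma eq_union_iff {Λ J A : Finset (Site ν)} (hJ : J ⊆ Λ) (K : OuterVol Λ) :
    A = J ∪ K.1 ↔ A ∩ Λ = J ∧ A \ Λ = K.1 := by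
  constructor
  · rintro rfl
    constructor
    · rw [Finset.union_inter_distrib_right, Finset.inter_eq_left.mpr hJ,
        Finset.disjoint_iff_inter_eq_empty.mp K.2.symm, Finset.union_empty]
    · rw [Finset.union_sdiff_distrib, Finset.sdiff_eq_empty_iff_subset.mpr hJ, Finset.empty_union,
        Finset.sdiff_eq_self_of_disjoint K.2.symm]
  · rintro ⟨h1, h2⟩
    rw [← h1, ← h2, Finset.union_comm, Finset.sdiff_union_inter]

/-- The sets with trace `J` on `Λ` are sorted by their exterior part `A p \ Λ`, and the sum is taken
fibrewise. -/
lemma hasSum_tsum_union (A : ι → Finset (Site ν)) (f : ι → ℝ) {Λ J : Finset (Site ν)}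
    (hJ : J ⊆ Λ) (hf : Summable fun p => if A p ∩ Λ = J then f p else 0) :
    HasSum (fun K : OuterVol Λ => ∑' p, if A p = J ∪ K.1 then f p else 0)
      (∑' p, if A p ∩ Λ = J then f p else 0) := by
  let g : ι → OuterVol Λ := fun p => ⟨A p \ Λ, Finset.disjoint_sdiff⟩
  suffices h : (fun K : OuterVol Λ => ∑' p, if A p = J ∪ K.1 then f p else 0) =
      fun K => ∑' p : g ⁻¹' {K}, if A p ∩ Λ = J then f p else 0 by
    rw [h]
    exact hf.hasSum.tsum_fiberwise g
  funext K
  rw [tsum_subtype (g ⁻¹' {K}) fun p => if A p ∩ Λ = J then f p else 0]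
  refine tsum_congr fun p => ?_
  by_cases h : A p \ Λ = K.1
  · rw [Set.indicator_of_mem (show p ∈ g ⁻¹' {K} from Subtype.ext h)]
    simp [eq_union_iff hJ K, h]
  · rw [Set.indicator_of_notMem fun h' : p ∈ g ⁻¹' {K} => h (congrArg Subtype.val h')]
    simp [eq_union_iff hJ K, h]

theorem exists_potential_of_family [Nonempty X] (A : ι → Finset (Site ν))
    (F : ι → (Site ν → X) → ℝ) (c : ι → ℝ)
    (hloc : ∀ p ω η, (∀ s ∈ A p, ω s = η s) → F p ω = F p η)
    (hbound : ∀ p ω, |F p ω| ≤ c p)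
    (hsum : ∀ t, Summable fun p => if t ∈ A p then c p else 0) :
    ∃ Φ : Potential ν X, Φ.UniformlyConvergent ∧
      ∀ (Λ : Finset (Site ν)) (xbar : OuterConfig X Λ) (x : Config X Λ),
        HasSum (fun p => if Disjoint Λ (A p) then 0 else F p (glue x xbar))
          (Φ.energy Λ xbar x) := by
  set θ : X := Classical.arbitrary X
  have hc : ∀ p, 0 ≤ c p := fun p => (abs_nonneg _).trans (hbound p fun _ => θ)
  have hsumJ : ∀ {Λ J : Finset (Site ν)}, J.Nonempty →
      Summable fun p => if A p ∩ Λ = J then c p else 0 := by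
    rintro Λ J ⟨t, ht⟩
    refine (hsum t).of_nonneg_of_le (fun p => ite_nonneg (hc p) le_rfl) fun p => ?_
    split_ifs with h1 h2 h2
    · exact le_rfl
    · exact absurd (Finset.mem_of_mem_inter_left (h1 ▸ ht)) h2
    · exact hc p
    · exact le_rfl
  -- The filling by `θ` outside `B` is immaterial, since `F p` depends only on `A p = B`.
  let Φ : Potential ν X := fun B x => ∑' p, if A p = B then F p (glue x fun _ => θ) else 0
  have hterm : ∀ {Λ : Finset (Site ν)} (x : Config X Λ) (xbar : OuterConfig X Λ) J K,
      Φ.term x xbar J K = ∑' p, if A p = J ∪ K.1 then F p (glue x xbar) else 0 := by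
    intro Λ x xbar J K
    refine tsum_congr fun p => ?_
    split_ifs with h
    · refine hloc p _ _ fun s hs => ?_
      rw [glue_of_mem _ _ (h ▸ hs)]
      rfl
    · rfl
  have hsumF : ∀ {Λ J : Finset (Site ν)}, J.Nonempty → ∀ ω,
      Summable fun p => if A p ∩ Λ = J then F p ω else 0 := by
    intro Λ J hJ ω
    refine Summable.of_norm_bounded (hsumJ (Λ := Λ) hJ) fun p => ?_
    split_ifs
    · exact hbound p ω
    · simp
  have hasSum : ∀ {Λ : Finset (Site ν)} (x : Config X Λ) (xbar : OuterConfig X Λ)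
      {J : Finset (Site ν)}, J.Nonempty → J ⊆ Λ → HasSum (fun K => Φ.term x xbar J K)
        (∑' p, if A p ∩ Λ = J then F p (glue x xbar) else 0) := by
    intro Λ x xbar J hne hJ
    simp only [hterm]
    exact hasSum_tsum_union A (fun p => F p (glue x xbar)) hJ (hsumF hne _)
  refine ⟨Φ, fun t a => ⟨fun xbar => (hasSum _ _ (by simp) subset_rfl).summable, ?_⟩, ?_⟩
  · have hu := (hasSum_tsum_union A c (subset_refl {t})
      (hsumJ (Finset.singleton_nonempty t))).summable
    refine tendstoUniformly_tsum hu fun K xbar => ?_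
    rw [hterm]
    have hs : Summable fun p => if A p = {t} ∪ K.1 then c p else 0 := by
      refine (hsum t).of_nonneg_of_le (fun p => ite_nonneg (hc p) le_rfl) fun p => ?_
      split_ifs with h1 h2 h2
      · exact le_rfl
      · exact absurd (h1 ▸ by simp) h2
      · exact hc p
      · exact le_rfl
    refine tsum_of_norm_bounded hs.hasSum fun p => ?_
    split_ifs
    · exact hbound p _
    · simp
  · intro Λ xbar x
    have h1 : Φ.energy Λ xbar x = ∑ J ∈ Λ.powerset with J.Nonempty,
        ∑' p, if A p ∩ Λ = J then F p (glue x xbar) else 0 :=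
      Finset.sum_congr rfl fun J hJ => by
        rw [Finset.mem_filter, Finset.mem_powerset] at hJ
        exact (hasSum x xbar hJ.2 hJ.1).tsum_eq
    rw [h1]
    -- An index `p` contributes only at `J = A p ∩ Λ`, which is admissible exactly when `A p` meets
    -- `Λ`.
    convert hasSum_sum fun J hJ => (hsumF (Finset.mem_filter.mp hJ).2 (glue x xbar)).hasSum
      using 2 with p
    rw [Finset.sum_ite_eq]
    simp [Finset.disjoint_iff_inter_eq_empty, Finset.inter_comm Λ, Finset.nonempty_iff_ne_empty]

end PotentialOfFamily
end GibbsField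

/-! ### From nonnullness and (E) to a potential. -/

namespace GibbsField

variable {ν : ℕ} {X : Type*}

lemma tendsto_box (ν : ℕ) : Tendsto (box ν) atTop atTop :=
  tendsto_atTop_finset_of_monotone (monotone_box ν) exists_mem_box

lemma abs_log_sub_log_le {ε x y : ℝ} (hε : 0 < ε) (hx : ε ≤ x) (hy : ε ≤ y) :
    |Real.log x - Real.log y| ≤ |x - y| / ε := by
  have key : ∀ {x y : ℝ}, ε ≤ x → ε ≤ y → Real.log x - Real.log y ≤ |x - y| / ε := by
    intro x y hx hy
    have hx0 := hε.trans_le hx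
    have hy0 := hε.trans_le hy
    rw [← Real.log_div hx0.ne' hy0.ne']
    refine (Real.log_le_sub_one_of_pos (div_pos hx0 hy0)).trans ?_
    rw [div_sub_one hy0.ne']
    exact div_le_div₀ (abs_nonneg _) (le_abs_self _) hε hy
  exact abs_sub_le_iff.mpr ⟨key hx hy, abs_sub_comm x y ▸ key hy hx⟩

section Mask

/-- The configuration `ω` in which the values at the sites of code less than `i` are replaced
by `θ`. -/
def mask (θ : X) (i : ℕ) (ω : Site ν → X) : Site ν → X :=
  fun s => if Encodable.encode s < i then θ else ω s

lemma mask_zero (θ : X) (ω : Site ν → X) : mask θ 0 ω = ω := by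
  funext s; simp [mask]

lemma mask_succ (θ : X) {i : ℕ} {s : Site ν} (hs : Encodable.encode s = i) (ω : Site ν → X) :
    mask θ (i + 1) ω = Function.update (mask θ i ω) s θ := by
  funext r
  by_cases hr : r = s
  · subst hr; simp [mask, hs]
  · have : Encodable.encode r ≠ i := fun h => hr (Encodable.encode_injective (h.trans hs.symm))
    have : Encodable.encode r < i + 1 ↔ Encodable.encode r < i := by omega
    simp [mask, hr, this]

lemma mask_succ_of_ne (θ : X) {i : ℕ} (hi : ∀ s : Site ν, Encodable.encode s ≠ i)
    (ω : Site ν → X) : mask θ (i + 1) ω = mask θ i ω := by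
  funext r
  have : Encodable.encode r < i + 1 ↔ Encodable.encode r < i := by have := hi r; omega
  simp [mask, this]

lemma mask_eq_of_eq (θ : X) {i : ℕ} {ω η : Site ν → X}
    (h : ∀ s, i ≤ Encodable.encode s → ω s = η s) : mask θ i ω = mask θ i η := by
  funext r
  unfold mask
  split_ifs with hr
  · rfl
  · exact h r (not_lt.mp hr)

end Mask

variable [MeasurableSpace X]

/-- The logarithm of the probability that the random field agrees with `ω` on `Λ`. -/
noncomputable def logCyl (P : Measure (Site ν → X)) (Λ : Finset (Site ν)) (ω : Site ν → X) : ℝ :=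
  Real.log (cylProb P Λ ω)

/-- The increment of `logCyl` on a box when the value at the site of code `i` is replaced by `θ`,
the values at the sites of smaller code being already replaced. -/
noncomputable def logIncr (P : Measure (Site ν → X)) (θ : X) (i n : ℕ) (ω : Site ν → X) : ℝ :=
  logCyl P (box ν n) (mask θ i ω) - logCyl P (box ν n) (mask θ (i + 1) ω)

lemma logCyl_congr (P : Measure (Site ν → X)) {Λ : Finset (Site ν)} {ω η : Site ν → X}
    (h : ∀ s ∈ Λ, ω s = η s) : logCyl P Λ ω = logCyl P Λ η := by
  rw [logCyl, cylProb_congr P h, logCyl]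

/-- Sites of code below `i` are masked in both terms. This locality is what makes the final family
summable at each site. -/
lemma logIncr_congr (P : Measure (Site ν → X)) (θ : X) {i n : ℕ} {ω η : Site ν → X}
    (h : ∀ s ∈ box ν n, i ≤ Encodable.encode s → ω s = η s) :
    logIncr P θ i n ω = logIncr P θ i n η := by
  have key : ∀ j, i ≤ j →
      logCyl P (box ν n) (mask θ j ω) = logCyl P (box ν n) (mask θ j η) := by
    intro j hj
    refine logCyl_congr P fun s hs => ?_
    unfold mask
    split_ifs with hr
    · rfl
    · exact h s hs (hj.trans (not_lt.mp hr))
  rw [logIncr, logIncr, key i le_rfl, key (i + 1) i.le_succ]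

lemma sum_range_logIncr (P : Measure (Site ν → X)) (θ : X) (N n : ℕ) (ω : Site ν → X) :
    ∑ i ∈ Finset.range N, logIncr P θ i n ω =
      logCyl P (box ν n) ω - logCyl P (box ν n) (mask θ N ω) := by
  simp only [logIncr]
  rw [Finset.sum_range_sub' fun i => logCyl P (box ν n) (mask θ i ω), mask_zero]

lemma CondE.eventually_abs_sub_le {P : Measure (Site ν → X)} (hE : CondE P) (t : Site ν)
    (a : X) {δ : ℝ} (hδ : 0 < δ) :
    ∀ᶠ Λ : OuterVol {t} in atTop, ∀ M : Finset (Site ν), Λ.1 ⊆ M → t ∉ M → ∀ ω : Site ν → X,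
      |onePoint P t (M.restrict ω) a - onePoint P t (Λ.1.restrict ω) a| ≤ δ := by
  have h : Tendsto (oscE P t a) atTop (𝓝 0) := hE t a
  filter_upwards [(ENNReal.tendsto_nhds_zero.mp h) _ (ENNReal.ofReal_pos.mpr hδ)]
    with Λ hΛ M hM ht ω
  -- (E) concerns non-empty supports only; for `M = ∅` also `Λ = ∅` and the difference is zero.
  rcases M.eq_empty_or_nonempty with rfl | hne
  · have h0 := Finset.subset_empty.mp hM
    obtain ⟨Λ, hd⟩ := Λ
    obtain rfl : Λ = ∅ := h0
    simpa using hδ.le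
  · rw [← ENNReal.ofReal_le_ofReal_iff hδ.le]
    exact (le_oscE P ⟨M, hne, Finset.disjoint_singleton_left.mpr ht, M.restrict ω⟩ hM).trans hΛ

variable [Fintype X] [DiscreteMeasurableSpace X]

lemma exists_abs_logCyl_le (P : Measure (Site ν → X)) (Λ : Finset (Site ν)) :
    ∃ C, ∀ ω, |logCyl P Λ ω| ≤ C := by
  refine ⟨∑ c : Config X Λ, |Real.log (fdd P Λ c)|, fun ω => ?_⟩
  rw [logCyl, ← fdd_restrict]
  exact Finset.single_le_sum (f := fun c : Config X Λ => |Real.log (fdd P Λ c)|)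
    (fun _ _ => abs_nonneg _) (Finset.mem_univ _)

variable {P : Measure (Site ν → X)} [IsProbabilityMeasure P]

lemma exists_le_onePoint (hP : StrictlyPositive P) (hN : OnePointUniformlyNonnull P) (t : Site ν)
    (a : X) : ∃ ε, 0 < ε ∧ ∀ M : Finset (Site ν), t ∉ M → ∀ ω : Site ν → X,
      ε ≤ onePoint P t (M.restrict ω) a := by
  have := nonempty_of_probability P
  obtain ⟨ε, hε, h⟩ := hN t a
  set z : Config X (∅ : Finset (Site ν)) := Finset.restrict ∅ fun _ => a
  refine ⟨min ε (onePoint P t z a), lt_min hε ?_, fun M hM ω => ?_⟩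
  · rw [onePoint_restrict]
    exact div_pos (hP.cylProb_pos _ _) (hP.cylProb_pos _ _)
  · rcases M.eq_empty_or_nonempty with rfl | hne
    · rw [Subsingleton.elim (Finset.restrict ∅ ω) z]
      exact min_le_right _ _
    · exact (min_le_left _ _).trans
        (h ⟨M, hne, Finset.disjoint_singleton_left.mpr hM, M.restrict ω⟩)

/-- As `log P_{t ∪ M} = log q_t + log P_M` and the last term ignores the value at `t`, only
differences of `log q_t` remain; nonnullness makes the logarithm Lipschitz on the relevant range, so
(E) applies. -/
lemma exists_logCyl_update_sub_le (hP : StrictlyPositive P) (hN : OnePointUniformlyNonnull P)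
    (hE : CondE P) (t : Site ν) {δ : ℝ} (hδ : 0 < δ) :
    ∃ Γ : Finset (Site ν), ∀ Γ', Γ ⊆ Γ' → ∀ (ω : Site ν → X) (a b : X),
      |(logCyl P Γ' (Function.update ω t a) - logCyl P Γ' (Function.update ω t b)) -
        (logCyl P Γ (Function.update ω t a) - logCyl P Γ (Function.update ω t b))| ≤ δ := by
  have : Nonempty (OuterVol {t}) := ⟨⟨∅, Finset.disjoint_empty_right _⟩⟩
  have : IsDirectedOrder (OuterVol {t}) := ⟨fun Λ M =>
    ⟨⟨Λ.1 ∪ M.1, Finset.disjoint_union_right.mpr ⟨Λ.2, M.2⟩⟩, Finset.subset_union_left,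
      Finset.subset_union_right⟩⟩
  have h1 : ∀ a : X, ∀ᶠ Λ : OuterVol {t} in atTop, ∀ M : Finset (Site ν), Λ.1 ⊆ M → t ∉ M →
      ∀ ω : Site ν → X, |Real.log (onePoint P t (M.restrict ω) a) -
        Real.log (onePoint P t (Λ.1.restrict ω) a)| ≤ δ / 2 := by
    intro a
    obtain ⟨ε, hε, hle⟩ := exists_le_onePoint hP hN t a
    filter_upwards [hE.eventually_abs_sub_le t a (mul_pos (half_pos hδ) hε)] with Λ hΛ M hM ht ω
    refine (abs_log_sub_log_le hε (hle M ht ω)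
      (hle Λ.1 (Finset.disjoint_singleton_left.mp Λ.2) ω)).trans ?_
    rw [div_le_iff₀ hε]
    exact hΛ M hM ht ω
  obtain ⟨Λ, hΛ⟩ := (eventually_all.mpr h1).exists
  have hlog : ∀ (M : Finset (Site ν)) (ω : Site ν → X) (a : X),
      logCyl P ({t} ∪ M) (Function.update ω t a) =
        Real.log (onePoint P t (M.restrict ω) a) + logCyl P M ω := by
    intro M ω a
    rw [onePoint_restrict, Real.log_div (hP.cylProb_pos _ _).ne' (hP.cylProb_pos _ _).ne']
    simp [logCyl]
  refine ⟨{t} ∪ Λ.1, fun Γ' hΓ' ω a b => ?_⟩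
  have e : Γ' = {t} ∪ Γ'.erase t := by
    rw [← Finset.insert_eq, Finset.insert_erase (hΓ' (by simp))]
  have hsub : Λ.1 ⊆ Γ'.erase t := fun s hs => Finset.mem_erase.mpr
    ⟨fun h => Finset.disjoint_singleton_left.mp Λ.2 (h ▸ hs), hΓ' (Finset.mem_union_right _ hs)⟩
  rw [e, hlog, hlog, hlog, hlog]
  have ha := abs_le.mp (hΛ a _ hsub (Finset.notMem_erase t Γ') ω)
  have hb := abs_le.mp (hΛ b _ hsub (Finset.notMem_erase t Γ') ω)
  rw [abs_le]
  constructor <;> linarith [ha.1, ha.2, hb.1, hb.2]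

/-- The sites of `Λ` are changed one at a time; each change gives a Cauchy net. -/
lemma exists_tendsto_logCyl_sub (hP : StrictlyPositive P) (hN : OnePointUniformlyNonnull P)
    (hE : CondE P) (Λ : Finset (Site ν)) : ∀ ω η : Site ν → X, (∀ s ∉ Λ, ω s = η s) →
      ∃ l, Tendsto (fun Γ => logCyl P Γ ω - logCyl P Γ η) atTop (𝓝 l) := by
  induction Λ using Finset.induction_on with
  | empty =>
    intro ω η h
    obtain rfl : ω = η := funext fun s => h s (by simp)
    exact ⟨0, by simp⟩
  | insert t Λ _ ih =>
    intro ω η h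
    obtain ⟨l₁, h₁⟩ := ih (Function.update ω t (η t)) η fun s hs => by
      by_cases hst : s = t
      · subst hst; simp
      · simpa [hst] using h s (by simp [hst, hs])
    obtain ⟨l₂, h₂⟩ : ∃ l, Tendsto
        (fun Γ => logCyl P Γ ω - logCyl P Γ (Function.update ω t (η t))) atTop (𝓝 l) := by
      refine cauchySeq_tendsto_of_complete (Metric.cauchySeq_iff'.mpr fun ε hε => ?_)
      obtain ⟨Γ, hΓ⟩ := exists_logCyl_update_sub_le hP hN hE t (half_pos hε)
      refine ⟨Γ, fun Γ' hΓ' => ?_⟩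
      have := hΓ Γ' hΓ' ω (ω t) (η t)
      rw [Function.update_eq_self] at this
      rw [Real.dist_eq]
      linarith
    refine ⟨l₂ + l₁, (h₂.add h₁).congr fun Γ => ?_⟩
    ring

lemma finCond_eq_inv_sum_exp (hP : StrictlyPositive P) {Λ : Finset (Site ν)}
    (xbar : OuterConfig X Λ) (M : OuterVol Λ) (x : Config X Λ) :
    finCond P Λ (xbar.onVol M) x = (∑ y : Config X Λ,
      Real.exp (logCyl P (Λ ∪ M.1) (glue y xbar) - logCyl P (Λ ∪ M.1) (glue x xbar)))⁻¹ := by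
  conv_lhs => rw [← outer_glue x xbar]
  rw [onVol_outer, finCond_restrict, cylProb_eq_sum P M.2.symm, outer_glue, Finset.union_comm M.1,
    ← inv_div, Finset.sum_div]
  congr 1
  refine Finset.sum_congr rfl fun y _ => ?_
  rw [Real.exp_sub, logCyl, logCyl, Real.exp_log (hP.cylProb_pos _ _),
    Real.exp_log (hP.cylProb_pos _ _)]

lemma exists_logIncr_sub_le (hP : StrictlyPositive P) (hN : OnePointUniformlyNonnull P)
    (hE : CondE P) (θ : X) (i k : ℕ) : ∃ N, 1 ≤ N ∧ ∀ n, N ≤ n → ∀ m, N ≤ m → ∀ ω,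
      |logIncr P θ i n ω - logIncr P θ i m ω| ≤ (1 / 2) ^ k := by
  by_cases hi : ∃ s : Site ν, Encodable.encode s = i
  · obtain ⟨s, hs⟩ := hi
    obtain ⟨Γ, hΓ⟩ := exists_logCyl_update_sub_le hP hN hE s
      (show (0 : ℝ) < (1 / 2) ^ k / 2 by positivity)
    obtain ⟨N, hN⟩ := eventually_atTop.mp ((tendsto_box ν).eventually (eventually_ge_atTop Γ))
    refine ⟨N + 1, by omega, fun n hn m hm ω => ?_⟩
    have h1 := abs_le.mp (hΓ _ (hN n (by omega)) (mask θ i ω) (mask θ i ω s) θ)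
    have h2 := abs_le.mp (hΓ _ (hN m (by omega)) (mask θ i ω) (mask θ i ω s) θ)
    rw [← mask_succ θ hs, Function.update_eq_self] at h1 h2
    rw [logIncr, logIncr, abs_le]
    constructor <;> linarith [h1.1, h1.2, h2.1, h2.2]
  -- Not every natural number need be the code of a site; for such `i` the increment is zero.
  · push Not at hi
    refine ⟨1, le_rfl, fun n _ m _ ω => ?_⟩
    simp [logIncr, mask_succ_of_ne θ hi]

lemma exists_tendsto_logIncr (hP : StrictlyPositive P) (hN : OnePointUniformlyNonnull P)
    (hE : CondE P) (θ : X) (i : ℕ) (ω : Site ν → X) :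
    ∃ l, Tendsto (fun n => logIncr P θ i n ω) atTop (𝓝 l) := by
  refine cauchySeq_tendsto_of_complete (Metric.cauchySeq_iff'.mpr fun ε hε => ?_)
  obtain ⟨k, hk⟩ := exists_pow_lt_of_lt_one hε (show (1 / 2 : ℝ) < 1 by norm_num)
  obtain ⟨N, -, h⟩ := exists_logIncr_sub_le hP hN hE θ i k
  exact ⟨N, fun n hn => (h n hn N le_rfl ω).trans_lt hk⟩

theorem exists_potential_energy_sub (hP : StrictlyPositive P) (hN : OnePointUniformlyNonnull P)
    (hE : CondE P) : ∃ Φ : Potential ν X, Φ.UniformlyConvergent ∧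
      ∀ (Λ : Finset (Site ν)) (xbar : OuterConfig X Λ) (x y : Config X Λ) (l : ℝ),
        Tendsto (fun n => logCyl P (box ν n) (glue y xbar) - logCyl P (box ν n) (glue x xbar))
          atTop (𝓝 l) → Φ.energy Λ xbar x - Φ.energy Λ xbar y = l := by
  have := nonempty_of_probability P
  let θ : X := Classical.arbitrary X
  choose φ hφ1 hφ using fun i k => exists_logIncr_sub_le hP hN hE θ i k
  choose γ hγ using fun i ω => exists_tendsto_logIncr hP hN hE θ i ω
  choose b hb using exists_abs_logCyl_le P
  -- Partial sums make `r i` monotone with `r i (k + 1) ≥ φ i k`, and `φ ≥ 1` makes it unbounded.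
  let r : ℕ → ℕ → ℕ := fun i k => ∑ j ∈ Finset.range k, φ i j
  have hr : ∀ i k, r i (k + 1) = r i k + φ i k := fun i k => Finset.sum_range_succ _ _
  have hr_atTop : ∀ i, Tendsto (r i) atTop atTop := fun i =>
    tendsto_atTop_mono (fun k => by
      simpa using Finset.sum_le_sum fun j (_ : j ∈ Finset.range k) => hφ1 i j) tendsto_id
  let A : ℕ × ℕ → Finset (Site ν) := fun p =>
    (box ν (r p.1 (p.2 + 1))).filter fun s => p.1 ≤ Encodable.encode s
  -- Old minus new, because the energy is minus the logarithm of the probability.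
  let F : ℕ × ℕ → (Site ν → X) → ℝ := fun p ω =>
    logIncr P θ p.1 (r p.1 p.2) ω - logIncr P θ p.1 (r p.1 (p.2 + 1)) ω
  let c : ℕ × ℕ → ℝ := fun p =>
    -- The step from `r i 0` to `r i 1` has no Cauchy control, hence the crude bound at `0` and the
    -- shifted exponent.
    if p.2 = 0 then 2 * (b (box ν (r p.1 0)) + b (box ν (r p.1 1))) else (1 / 2) ^ (p.2 - 1)
  have hloc : ∀ p ω η, (∀ s ∈ A p, ω s = η s) → F p ω = F p η := by
    intro p ω η h
    have h1 : ∀ s ∈ box ν (r p.1 (p.2 + 1)), p.1 ≤ Encodable.encode s → ω s = η s :=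
      fun s hs hi => h s (Finset.mem_filter.mpr ⟨hs, hi⟩)
    have h2 : box ν (r p.1 p.2) ⊆ box ν (r p.1 (p.2 + 1)) :=
      monotone_box ν (by rw [hr]; exact Nat.le_add_right _ _)
    simp only [F]
    rw [logIncr_congr P θ h1, logIncr_congr P θ fun s hs => h1 s (h2 hs)]
  have hbound : ∀ p ω, |F p ω| ≤ c p := by
    rintro ⟨i, k⟩ ω
    rcases k with _ | k
    · have h1 := abs_le.mp (hb (box ν (r i 0)) (mask θ i ω))
      have h2 := abs_le.mp (hb (box ν (r i 0)) (mask θ (i + 1) ω))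
      have h3 := abs_le.mp (hb (box ν (r i 1)) (mask θ i ω))
      have h4 := abs_le.mp (hb (box ν (r i 1)) (mask θ (i + 1) ω))
      simp only [F, c, logIncr, if_true, zero_add]
      rw [abs_le]
      constructor <;> linarith [h1.1, h1.2, h2.1, h2.2, h3.1, h3.2, h4.1, h4.2]
    · simp only [F, c, Nat.add_one_ne_zero, if_false, Nat.add_sub_cancel]
      exact hφ i k _ (by rw [hr]; exact Nat.le_add_left _ _) _
        (by rw [hr, hr, add_assoc]; omega) ω
  have hc : ∀ p, 0 ≤ c p := fun p => (abs_nonneg _).trans (hbound p fun _ => θ)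
  have hsum : ∀ t, Summable fun p => if t ∈ A p then c p else 0 := by
    intro t
    rw [summable_prod_of_nonneg fun p => ite_nonneg (hc p) le_rfl]
    constructor
    · intro i
      have hci : Summable fun k => c (i, k) := by
        rw [← summable_nat_add_iff 1]
        simpa [c] using summable_geometric_two
      refine hci.of_nonneg_of_le (fun k => ite_nonneg (hc _) le_rfl) fun k => ?_
      split_ifs
      · exact le_rfl
      · exact hc _
    · refine summable_of_ne_finset_zero (s := Finset.range (Encodable.encode t + 1))
        fun i hi => ?_
      rw [Finset.mem_range, not_lt] at hi
      refine (tsum_congr fun k => if_neg fun h => ?_).trans tsum_zero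
      have := (Finset.mem_filter.mp h).2
      simp only at this
      omega
  obtain ⟨Φ, hΦ, hU⟩ := exists_potential_of_family A F c hloc hbound hsum
  refine ⟨Φ, hΦ, fun Λ xbar x y l hl => ?_⟩
  set ω := glue x xbar with hω
  set η := glue y xbar with hη
  have hoff : ∀ s ∉ Λ, ω s = η s := fun s hs => by
    rw [hω, hη, glue_of_notMem _ _ hs, glue_of_notMem _ _ hs]
  -- Terms with support disjoint from `Λ` cancel in the difference, so the restriction on `p` can be
  -- dropped.
  have h1 : HasSum (fun p => F p ω - F p η) (Φ.energy Λ xbar x - Φ.energy Λ xbar y) := by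
    have e : (fun p => F p ω - F p η) = fun p => (if Disjoint Λ (A p) then 0 else F p ω) -
        if Disjoint Λ (A p) then 0 else F p η := by
      funext p
      split_ifs with hd
      · rw [hloc p ω η fun s hs => hoff s (Finset.disjoint_right.mp hd hs)]
        simp
      · rfl
    rw [e]
    exact (hU Λ xbar x).sub (hU Λ xbar y)
  -- The telescoping starts at `r i 0 = 0`, where the box is empty and both increments agree.
  have h2 : ∀ i, HasSum (fun k => F (i, k) ω - F (i, k) η) (γ i η - γ i ω) := by
    intro i
    rw [(h1.summable.prod_factor i).hasSum_iff_tendsto_nat]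
    refine (((hγ i η).comp (hr_atTop i)).sub ((hγ i ω).comp (hr_atTop i))).congr fun K => ?_
    simp only [F, Function.comp]
    rw [Finset.sum_sub_distrib, Finset.sum_range_sub' fun k => logIncr P θ i (r i k) ω,
      Finset.sum_range_sub' fun k => logIncr P θ i (r i k) η,
      logIncr_congr P θ (i := i) (n := r i 0) (ω := ω) (η := η) (by simp [r, mem_box])]
    ring
  have h3 := h1.prod_fiberwise h2
  obtain ⟨N, hN'⟩ := ((tendsto_box ν).eventually (eventually_ge_atTop Λ)).exists
  have hmask : ∀ i, N ≤ i → mask θ i ω = mask θ i η := fun i hi =>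
    mask_eq_of_eq θ fun s hs => hoff s fun h => by
      have := mem_box.mp (hN' h)
      omega
  -- Once all of `Λ` is masked, `ω` and `η` coincide, so only `i < N` matters.
  have h4 : HasSum (fun i => γ i η - γ i ω) (∑ i ∈ Finset.range N, (γ i η - γ i ω)) := by
    refine hasSum_sum_of_ne_finset_zero fun i hi => ?_
    rw [Finset.mem_range, not_lt] at hi
    refine sub_eq_zero.mpr (tendsto_nhds_unique (hγ i η) ((hγ i ω).congr fun n => ?_))
    rw [logIncr, logIncr, hmask i hi, hmask (i + 1) (by omega)]
  rw [h3.unique h4]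
  refine tendsto_nhds_unique
    (tendsto_finsetSum _ fun i _ => (hγ i η).sub (hγ i ω)) (hl.congr fun n => ?_)
  rw [Finset.sum_sub_distrib, sum_range_logIncr, sum_range_logIncr, hmask N le_rfl]
  ring

theorem isGibbs_of_condE (hP : StrictlyPositive P) (hN : OnePointUniformlyNonnull P)
    (hE : CondE P) : IsGibbs P := by
  have := nonempty_of_probability P
  obtain ⟨Φ, hΦ, hU⟩ := exists_potential_energy_sub hP hN hE
  refine ⟨Φ, hΦ, fun Λ xbar => ⟨fun x => (gibbsSpec_pos Φ Λ xbar x).le, ?_⟩,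
    fun Λ M hM hMex => Eventually.of_forall fun xbar x => ?_⟩
  · simp only [Potential.gibbsSpec]
    rw [← Finset.sum_div, div_self]
    exact (Finset.sum_pos (fun _ _ => Real.exp_pos _) Finset.univ_nonempty).ne'
  · have hlim : Tendsto (fun n => Λ ∪ (M n).1) atTop atTop := by
      refine tendsto_atTop_finset_of_monotone
        (fun m n h => Finset.union_subset_union subset_rfl (hM h)) fun s => ?_
      by_cases hs : s ∈ Λ
      · exact ⟨0, Finset.mem_union_left _ hs⟩
      · exact (hMex s hs).imp fun n hn => Finset.mem_union_right _ hn
    have h1 : ∀ y : Config X Λ, Tendsto (fun n => logCyl P (Λ ∪ (M n).1) (glue y xbar) -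
        logCyl P (Λ ∪ (M n).1) (glue x xbar)) atTop
        (𝓝 (Φ.energy Λ xbar x - Φ.energy Λ xbar y)) := by
      intro y
      obtain ⟨l, hl⟩ := exists_tendsto_logCyl_sub hP hN hE Λ (glue y xbar) (glue x xbar)
        fun s hs => by rw [glue_of_notMem _ _ hs, glue_of_notMem _ _ hs]
      -- The limit exists along all finite sets, so boxes and `Λ ∪ M n` give the same value, for
      -- every `xbar`.
      rw [hU Λ xbar x y l (hl.comp (tendsto_box ν))]
      exact hl.comp hlim
    have h2 : Φ.gibbsSpec Λ xbar x =
        (∑ y, Real.exp (Φ.energy Λ xbar x - Φ.energy Λ xbar y))⁻¹ := by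
      rw [Potential.gibbsSpec, ← inv_div, Finset.sum_div]
      congr 1
      refine Finset.sum_congr rfl fun y _ => ?_
      rw [← Real.exp_sub]
      congr 1
      ring
    simp only [finCond_eq_inv_sum_exp hP]
    rw [h2]
    exact (tendsto_finsetSum _ fun y _ => (Real.continuous_exp.tendsto _).comp (h1 y)).inv₀
      (Finset.sum_pos (fun _ _ => Real.exp_pos _) Finset.univ_nonempty).ne'

lemma isGibbs_iff_condE :
    IsGibbs P ↔ StrictlyPositive P ∧ OnePointUniformlyNonnull P ∧ CondE P :=
  ⟨fun h => ⟨h.strictlyPositive, h.onePointUniformlyNonnull,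
    (condC_iff_condE h.strictlyPositive).mp h.condC⟩, fun h => isGibbs_of_condE h.1 h.2.1 h.2.2⟩

end GibbsField

theorem mainTheorem2 (ν : ℕ) (X : Type*) [Fintype X] [MeasurableSpace X]
    [DiscreteMeasurableSpace X] (P : MeasureTheory.Measure (GibbsField.Site ν → X))
    [MeasureTheory.IsProbabilityMeasure P] :
    (GibbsField.StrictlyPositive P →
      (GibbsField.CondC P ↔ GibbsField.CondD P) ∧
      (GibbsField.CondD P ↔ GibbsField.CondE P) ∧
      (GibbsField.CondC P ↔ GibbsField.CondE P)) ∧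
    (GibbsField.IsGibbs P ↔
      GibbsField.StrictlyPositive P ∧ GibbsField.OnePointUniformlyNonnull P ∧
        GibbsField.CondC P) ∧
    (GibbsField.IsGibbs P ↔
      GibbsField.StrictlyPositive P ∧ GibbsField.OnePointUniformlyNonnull P ∧
        GibbsField.CondD P) ∧
    (GibbsField.IsGibbs P ↔
      GibbsField.StrictlyPositive P ∧ GibbsField.OnePointUniformlyNonnull P ∧
        GibbsField.CondE P) := by
  have hCD := fun hP : GibbsField.StrictlyPositive P => GibbsField.condC_iff_condD hP
  have hCE := fun hP : GibbsField.StrictlyPositive P => GibbsField.condC_iff_condE hP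
  have hG := GibbsField.isGibbs_iff_condE (P := P)
  refine ⟨fun hP => ⟨hCD hP, (hCD hP).symm.trans (hCE hP), hCE hP⟩, ?_, ?_, hG⟩
  · rw [hG]
    exact and_congr_right fun hP => and_congr_right fun _ => (hCE hP).symm
  · rw [hG]
    exact and_congr_right fun hP => and_congr_right fun _ => (hCE hP).symm.trans (hCD hP)
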